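/- A Moufang loop is a set with a multiplication, a neutral element $e$ and unique left and right division, satisfying $xy\cdot zx = x(yz\cdot x)$ for all $x,y,z$. For a group $G$ of finite order $n$, Chein's loop $M_{2n}(G,2)$ is the set of formal elements $gu^{\alpha}$ ($g\in G$, $\alpha\in\{0,1\}$) with multiplication $$gu^{\alpha}\cdot hu^{\beta}=\bigl(g^{(-1)^{\beta}}h^{(-1)^{\alpha+\beta}}\bigr)^{(-1)^{\beta}}u^{\alpha+\beta},$$ where the exponent $\alpha+\beta$ of $u$ is taken modulo $2$; $G$ is identified with the elements $gu^0$, and $u$ is the element $eu^1$. **Theorem.** Let $G=\langle x,y;R\rangle$ be a presentation, in the variety of groups, of a finite group $G$ of order $n$, where $R$ is a set of relations $v=w$ between bracketed words $v,w$ in $x,y$ (formed with $e$, the multiplication and the divisions $a\backslash b$, $a/b$, which in groups are $a^{-1}b$, $ab^{-1}$; the inverse $a^{-1}$ is written $a\backslash e$). Then, in the variety of Moufang loops, $M_{2n}(G,2)$ is presented by $$\langle x,y,u;\ R,\ u^2=(xu)^2=(yu)^2=(xy\cdot u)^2=e\rangle .$$ That is, the Moufang loop freely generated by $x,y,u$ subject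 to these relations is isomorphic to $M_{2n}(G,2)$ by an isomorphism that sends the generators $x,y,u$ to the elements $x,y\in G$ and $u$ of $M_{2n}(G,2)$. -/

import Mathlib

/-- Moufang loops, as a variety with operations `·`, `1`, left division `ldiv a b = a \ b` and
right division `rdiv b a = b / a`: loops satisfying the Moufang identity `xy·zx = x(yz·x)`. -/
class MoufangLoop (L : Type*) extends MulOneClass L where
  ldiv : L → L → L
  rdiv : L → L → L
  mul_ldiv : ∀ a b : L, a * ldiv a b = b
  ldiv_mul : ∀ a b : L, ldiv a (a * b) = b
  rdiv_mul : ∀ a b : L, rdiv b a * a = b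
  mul_rdiv : ∀ a b : L, rdiv (b * a) a = b
  moufang : ∀ x y z : L, (x * y) * (z * x) = x * ((y * z) * x)

/-- Words (terms) in the language of loops, on a set `α` of generators. Words are bracketed.
The inverse of a word `w` is written `ldiv w one`. -/
inductive LoopWord (α : Type) : Type
  | var : α → LoopWord α
  | one : LoopWord α
  | mul : LoopWord α → LoopWord α → LoopWord α
  | ldiv : LoopWord α → LoopWord α → LoopWord α
  | rdiv : LoopWord α → LoopWord α → LoopWord α

namespace LoopWord

/-- Rename the generators of a word. -/
def map {α β : Type} (f : α → β) : LoopWord α → LoopWord β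
  | var a => var (f a)
  | one => one
  | mul v w => mul (map f v) (map f w)
  | ldiv v w => ldiv (map f v) (map f w)
  | rdiv v w => rdiv (map f v) (map f w)

/-- The square of a word. -/
def sq {α : Type} (w : LoopWord α) : LoopWord α := mul w w

/-- The element of the free group that a word represents when it is read in groups, where
`v \ w = v⁻¹ w` and `v / w = v w⁻¹`. -/
def toFreeGroup {α : Type} : LoopWord α → FreeGroup α
  | var a => FreeGroup.of a
  | one => 1
  | mul v w => toFreeGroup v * toFreeGroup w
  | ldiv v w => (toFreeGroup v)⁻¹ * toFreeGroup w
  | rdiv v w => toFreeGroup v * (toFreeGroup w)⁻¹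

end LoopWord

/-- The group `⟨α; R⟩` presented, in the variety of groups, by the relations `v = w` for
`(v, w) ∈ R`. -/
abbrev GroupPresentedBy {α : Type} (R : Set (LoopWord α × LoopWord α)) : Type :=
  PresentedGroup ((fun p : LoopWord α × LoopWord α => p.1.toFreeGroup * (p.2.toFreeGroup)⁻¹) '' R)

/-- `G = ⟨α; R⟩` as a group, the generator `a : α` being the element `v a` of `G`. -/
def IsGroupPresentation {α : Type} (R : Set (LoopWord α × LoopWord α))
    {G : Type*} [Group G] (v : α → G) : Prop :=
  ∃ φ : GroupPresentedBy R ≃* G, ∀ a : α, φ (PresentedGroup.of a) = v a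

/-- `MoufangDerivable R v w`: the equation `v = w` can be derived from the relations in `R` and
the defining identities of Moufang loops. It is the least congruence on words that contains `R`
and whose quotient is a Moufang loop. -/
inductive MoufangDerivable {α : Type} (R : Set (LoopWord α × LoopWord α)) :
    LoopWord α → LoopWord α → Prop
  | rel {v w : LoopWord α} : (v, w) ∈ R → MoufangDerivable R v w
  | refl (v : LoopWord α) : MoufangDerivable R v v
  | symm {v w : LoopWord α} : MoufangDerivable R v w → MoufangDerivable R w v
  | trans {u v w : LoopWord α} :
      MoufangDerivable R u v → MoufangDerivable R v w → MoufangDerivable R u w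
  | mul_congr {v v' w w' : LoopWord α} : MoufangDerivable R v v' → MoufangDerivable R w w' →
      MoufangDerivable R (.mul v w) (.mul v' w')
  | ldiv_congr {v v' w w' : LoopWord α} : MoufangDerivable R v v' → MoufangDerivable R w w' →
      MoufangDerivable R (.ldiv v w) (.ldiv v' w')
  | rdiv_congr {v v' w w' : LoopWord α} : MoufangDerivable R v v' → MoufangDerivable R w w' →
      MoufangDerivable R (.rdiv v w) (.rdiv v' w')
  | one_mul (a : LoopWord α) : MoufangDerivable R (.mul .one a) a
  | mul_one (a : LoopWord α) : MoufangDerivable R (.mul a .one) a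
  | mul_ldiv (a b : LoopWord α) : MoufangDerivable R (.mul a (.ldiv a b)) b
  | ldiv_mul (a b : LoopWord α) : MoufangDerivable R (.ldiv a (.mul a b)) b
  | rdiv_mul (a b : LoopWord α) : MoufangDerivable R (.mul (.rdiv b a) a) b
  | mul_rdiv (a b : LoopWord α) : MoufangDerivable R (.rdiv (.mul b a) a) b
  | moufang (x y z : LoopWord α) : MoufangDerivable R
      (.mul (.mul x y) (.mul z x)) (.mul x (.mul (.mul y z) x))

/-- The congruence of derivable equality. -/
def moufangSetoid {α : Type} (R : Set (LoopWord α × LoopWord α)) : Setoid (LoopWord α) where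
  r := MoufangDerivable R
  iseqv := ⟨.refl, .symm, .trans⟩

/-- The Moufang loop `⟨α; R⟩` presented, in the variety of Moufang loops, by the relations `v = w`
for `(v, w) ∈ R`. -/
def MoufangPresentedBy {α : Type} (R : Set (LoopWord α × LoopWord α)) : Type :=
  Quotient (moufangSetoid R)

namespace MoufangPresentedBy

variable {α : Type} {R : Set (LoopWord α × LoopWord α)}

/-- The element of the presented Moufang loop that a word represents. -/
def mk (R : Set (LoopWord α × LoopWord α)) (w : LoopWord α) : MoufangPresentedBy R :=
  Quotient.mk (moufangSetoid R) w

/-- The canonical generators of the presented Moufang loop. -/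
def of (R : Set (LoopWord α × LoopWord α)) (a : α) : MoufangPresentedBy R := mk R (.var a)

instance : MoufangLoop (MoufangPresentedBy R) where
  one := mk R .one
  mul := Quotient.map₂ .mul (fun _ _ h _ _ k => MoufangDerivable.mul_congr h k)
  ldiv := Quotient.map₂ .ldiv (fun _ _ h _ _ k => MoufangDerivable.ldiv_congr h k)
  rdiv := Quotient.map₂ .rdiv (fun _ _ h _ _ k => MoufangDerivable.rdiv_congr h k)
  one_mul := by rintro ⟨a⟩; exact Quotient.sound (.one_mul a)
  mul_one := by rintro ⟨a⟩; exact Quotient.sound (.mul_one a)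
  mul_ldiv := by rintro ⟨a⟩ ⟨b⟩; exact Quotient.sound (.mul_ldiv a b)
  ldiv_mul := by rintro ⟨a⟩ ⟨b⟩; exact Quotient.sound (.ldiv_mul a b)
  rdiv_mul := by rintro ⟨a⟩ ⟨b⟩; exact Quotient.sound (.rdiv_mul a b)
  mul_rdiv := by rintro ⟨a⟩ ⟨b⟩; exact Quotient.sound (.mul_rdiv a b)
  moufang := by rintro ⟨x⟩ ⟨y⟩ ⟨z⟩; exact Quotient.sound (.moufang x y z)

end MoufangPresentedBy

/-- `L = ⟨α; R⟩` in the variety of Moufang loops, the generator `a : α` being the element `v a`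
of `L`. (An isomorphism for the multiplication also respects `1` and both divisions.) -/
def IsMoufangPresentation {α : Type} (R : Set (LoopWord α × LoopWord α))
    {L : Type*} [MoufangLoop L] (v : α → L) : Prop :=
  ∃ φ : MoufangPresentedBy R ≃* L, ∀ a : α, φ (MoufangPresentedBy.of R a) = v a

/-- The underlying set of Chein's loop `M(G, 2)`: the formal elements `g u ^ α` with `g ∈ G` and
`α ∈ {0, 1}`, the exponent `α` being read modulo `2`. -/
@[ext]
structure CheinLoop (G : Type*) where
  elt : G
  exp : ZMod 2

namespace CheinLoop

theorem cases_exp {H : Type*} {p : CheinLoop H → Prop} (h0 : ∀ g, p ⟨g, 0⟩)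
    (h1 : ∀ g, p ⟨g, 1⟩) :
    ∀ a, p a := by
  rintro ⟨g, e⟩
  fin_cases e
  · exact h0 g
  · exact h1 g

variable {G : Type*} [Group G]

/-- Chein's multiplication
`g u^α · h u^β = (g^((-1)^β) h^((-1)^(α+β)))^((-1)^β) u^(α+β)`. -/
instance : Mul (CheinLoop G) where
  mul a b :=
    ⟨(a.elt ^ ((-1 : ℤ) ^ b.exp.val) * b.elt ^ ((-1 : ℤ) ^ (a.exp + b.exp).val)) ^
        ((-1 : ℤ) ^ b.exp.val), a.exp + b.exp⟩

/-- The embedding of `G`. -/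
def ofGroup (g : G) : CheinLoop G := ⟨g, 0⟩

/-- The new element `u`. -/
def u : CheinLoop G := ⟨1, 1⟩

instance : One (CheinLoop G) := ⟨ofGroup 1⟩

/-- Inverses: `g⁻¹` for `g ∈ G`, while `g u` is its own inverse. -/
instance : Inv (CheinLoop G) := ⟨fun a => ⟨if a.exp = 0 then a.elt⁻¹ else a.elt, a.exp⟩⟩

theorem mk_zero_mul_mk_zero (g h : G) : (⟨g, 0⟩ : CheinLoop G) * ⟨h, 0⟩ = ⟨g * h, 0⟩ := by
  change CheinLoop.mk _ _ = _
  simp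

theorem mk_one_mul_mk_zero (g h : G) : (⟨g, 1⟩ : CheinLoop G) * ⟨h, 0⟩ = ⟨g * h⁻¹, 1⟩ := by
  change CheinLoop.mk _ _ = _
  simp [ZMod.val_one]

theorem mk_zero_mul_mk_one (g h : G) : (⟨g, 0⟩ : CheinLoop G) * ⟨h, 1⟩ = ⟨h * g, 1⟩ := by
  change CheinLoop.mk _ _ = _
  simp [ZMod.val_one]

theorem mk_one_mul_mk_one (g h : G) : (⟨g, 1⟩ : CheinLoop G) * ⟨h, 1⟩ = ⟨h⁻¹ * g, 0⟩ := by
  have h2 : (1 : ZMod 2) + 1 = 0 := rfl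
  change CheinLoop.mk _ _ = _
  simp [ZMod.val_one, h2]

theorem one_def : (1 : CheinLoop G) = ⟨1, 0⟩ := rfl

theorem inv_mk_zero (g : G) : (⟨g, 0⟩ : CheinLoop G)⁻¹ = ⟨g⁻¹, 0⟩ := rfl

theorem inv_mk_one (g : G) : (⟨g, 1⟩ : CheinLoop G)⁻¹ = ⟨g, 1⟩ := rfl

instance : MoufangLoop (CheinLoop G) where
  ldiv a b := a⁻¹ * b
  rdiv b a := b * a⁻¹
  one_mul := by
    refine cases_exp ?_ ?_ <;> intro g <;>
      simp [one_def, mk_zero_mul_mk_zero, mk_zero_mul_mk_one]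
  mul_one := by
    refine cases_exp ?_ ?_ <;> intro g <;>
      simp [one_def, mk_zero_mul_mk_zero, mk_one_mul_mk_zero]
  mul_ldiv := by
    refine cases_exp ?_ ?_ <;> intro g <;> refine cases_exp ?_ ?_ <;> intro h <;>
      simp [inv_mk_zero, inv_mk_one, mk_zero_mul_mk_zero, mk_one_mul_mk_zero,
        mk_zero_mul_mk_one, mk_one_mul_mk_one]
  ldiv_mul := by
    refine cases_exp ?_ ?_ <;> intro g <;> refine cases_exp ?_ ?_ <;> intro h <;>
      simp [inv_mk_zero, inv_mk_one, mk_zero_mul_mk_zero, mk_one_mul_mk_zero,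
        mk_zero_mul_mk_one, mk_one_mul_mk_one]
  rdiv_mul := by
    refine cases_exp ?_ ?_ <;> intro g <;> refine cases_exp ?_ ?_ <;> intro h <;>
      simp [inv_mk_zero, inv_mk_one, mk_zero_mul_mk_zero, mk_one_mul_mk_zero,
        mk_zero_mul_mk_one, mk_one_mul_mk_one]
  mul_rdiv := by
    refine cases_exp ?_ ?_ <;> intro g <;> refine cases_exp ?_ ?_ <;> intro h <;>
      simp [inv_mk_zero, inv_mk_one, mk_zero_mul_mk_zero, mk_one_mul_mk_zero,
        mk_zero_mul_mk_one, mk_one_mul_mk_one]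
  moufang := by
    refine cases_exp ?_ ?_ <;> intro g <;> refine cases_exp ?_ ?_ <;> intro h <;>
      refine cases_exp ?_ ?_ <;> intro k <;>
      simp [mk_zero_mul_mk_zero, mk_one_mul_mk_zero,
        mk_zero_mul_mk_one, mk_one_mul_mk_one, mul_assoc]

end CheinLoop

/-- The relations `R, u² = (xu)² = (yu)² = (xy·u)² = e` in the generators `x = 0`, `y = 1`,
`u = 2`, where `R` is a set of relations in the generators `x = 0`, `y = 1`. -/
def cheinRelations (R : Set (LoopWord (Fin 2) × LoopWord (Fin 2))) :
    Set (LoopWord (Fin 3) × LoopWord (Fin 3)) :=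
  let x : LoopWord (Fin 3) := .var 0
  let y : LoopWord (Fin 3) := .var 1
  let u : LoopWord (Fin 3) := .var 2
  Prod.map (LoopWord.map Fin.castSucc) (LoopWord.map Fin.castSucc) '' R ∪
    {(u.sq, .one), ((x.mul u).sq, .one), ((y.mul u).sq, .one), (((x.mul y).mul u).sq, .one)}

/-! Let `L` be the presented loop. Sending generators to generators gives `L → M(G, 2)`, since every
`g u` squares to the identity there. For an inverse, two facts about `L` are needed.
Diassociativity: `x` and `y` generate a group in `L`, so `R` yields a multiplicative map `f : G → L`
(`freeEval_mul`, `IsGroupPresentation.map_eq_of_lift_eq`). Inversion: `u (g u) = g⁻¹` for all `g` in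
that group (`conj_freeEval`). The four added relations say this for `1, x, y, xy`, and Moufang's
identities carry it from `a, b` to `a b⁻¹ a`. Both rest on `TwistedClosure.freeGroup`: in the free
group on `x, y`, the elements `1, x, y, xy` produce everything under `a b⁻¹ a`, an operation that,
unlike the product, Moufang identities control. Inversion then forces Chein's multiplication, so `g
u^α ↦ f(g) u^α` is multiplicative, and it inverts the first map. -/

namespace MoufangLoop

/-! ### Inverse properties and the left and right Moufang identities. -/

variable {L : Type*} [MoufangLoop L]

/-- The inverse of an element of a Moufang loop. -/
def inv (a : L) : L := ldiv a 1

theorem mul_left_cancel' {a b c : L} (h : a * b = a * c) : b = c := by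
  rw [← ldiv_mul a b, h, ldiv_mul]

theorem mul_right_cancel' {a b c : L} (h : b * a = c * a) : b = c := by
  rw [← mul_rdiv a b, h, mul_rdiv]

theorem flexible (x y : L) : x * y * x = x * (y * x) := by
  simpa using moufang x y 1

theorem mul_inv (a : L) : a * inv a = 1 := mul_ldiv a 1

theorem mul_inv_mul (x z : L) : x * (inv x * z) = z := by
  refine mul_right_cancel' (a := x) ?_
  have h := moufang x (inv x) z
  rw [mul_inv, one_mul] at h
  rw [flexible, ← h]

theorem inv_mul (a : L) : inv a * a = 1 :=
  mul_left_cancel' (a := a) (by rw [mul_inv_mul, mul_one])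

theorem inv_unique {a b : L} (h : a * b = 1) : b = inv a :=
  mul_left_cancel' (a := a) (by rw [h, mul_inv])

theorem inv_inv (a : L) : inv (inv a) = a := (inv_unique (inv_mul a)).symm

theorem inv_one : inv (1 : L) = 1 := (inv_unique (mul_one 1)).symm

theorem inv_mul_mul (x z : L) : inv x * (x * z) = z := by
  simpa [inv_inv] using mul_inv_mul (inv x) z

theorem mul_inv_cancel_right' (z x : L) : z * inv x * x = z := by
  refine mul_left_cancel' (a := x) ?_
  have h := moufang x z (inv x)
  rw [inv_mul, mul_one] at h
  exact h.symm

theorem mul_mul_inv (z x : L) : z * x * inv x = z := by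
  simpa [inv_inv] using mul_inv_cancel_right' z (inv x)

theorem inv_mul_rev (a b : L) : inv (a * b) = inv b * inv a := by
  refine mul_left_cancel' (a := a * b) (mul_right_cancel' (a := a) ?_)
  rw [mul_inv, one_mul]
  have h : inv (a * b) * a = inv b := by
    simpa only [mul_mul_inv] using inv_mul_mul (a * b) (inv b)
  rw [← h, mul_mul_inv, mul_inv, one_mul]

theorem ldiv_eq (a b : L) : ldiv a b = inv a * b :=
  mul_left_cancel' (a := a) (by rw [mul_ldiv, mul_inv_mul])

theorem rdiv_eq (a b : L) : rdiv b a = b * inv a :=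
  mul_right_cancel' (a := a) (by rw [rdiv_mul, mul_inv_cancel_right'])

theorem eq_inv_mul {a b c : L} (h : a * b = c) : b = inv a * c := by
  rw [← h, inv_mul_mul]

theorem eq_mul_inv {a b c : L} (h : a * b = c) : a = c * inv b := by
  rw [← h, mul_mul_inv]

/-- The Moufang identity gives `(x(ab))(b⁻¹x) = x(ax)`; divide on the right by `b⁻¹x`. -/
theorem conj_mul_inv_mul (x a b : L) : (x * (a * x)) * (inv x * b) = x * (a * b) := by
  have h := moufang x (a * b) (inv b)
  rw [mul_mul_inv] at h
  have h2 := eq_mul_inv h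
  rw [inv_mul_rev, inv_inv] at h2
  exact h2.symm

theorem left_moufang (x y z : L) : (x * (y * x)) * z = x * (y * (x * z)) := by
  conv_lhs => rw [← inv_mul_mul x z]
  rw [conj_mul_inv_mul]

theorem right_moufang (x y z : L) : z * (x * (y * x)) = ((z * x) * y) * x := by
  have h := congrArg inv (left_moufang (inv x) (inv y) (inv z))
  simp only [inv_mul_rev, inv_inv] at h
  rw [← flexible, h]

theorem left_alternative (x z : L) : (x * x) * z = x * (x * z) := by
  simpa using left_moufang x 1 z

/-! ### Symmetries of associating triples. -/

/-- The elements `x`, `y`, `z` associate in this order. -/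
def Assoc (x y z : L) : Prop := x * y * z = x * (y * z)

/-- Moufang with `z x⁻¹` for `z` reads `(xy)z = x((y(z x⁻¹))x)`; compare with `x(yz)` and cancel. -/
theorem assoc_rotate {x y z : L} : Assoc x y z ↔ Assoc y z (inv x) := by
  have h := moufang x y (z * inv x)
  rw [mul_inv_cancel_right'] at h
  unfold Assoc
  rw [h]
  constructor
  · intro k
    rw [← mul_left_cancel' k, mul_mul_inv]
  · intro k
    rw [← k, mul_inv_cancel_right']

theorem assoc_inv_rev {x y z : L} (h : Assoc x y z) : Assoc (inv z) (inv y) (inv x) := by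
  have k := congrArg inv h
  simp only [inv_mul_rev] at k
  exact k.symm

theorem assoc_reverse {x y z : L} (h : Assoc x y z) : Assoc z y x := by
  simpa only [inv_inv] using
    assoc_inv_rev (assoc_rotate.1 (assoc_rotate.1 (assoc_rotate.1 h)))

/-- The left Moufang identity gives `(y x⁻¹)(xz) = x⁻¹((xy)z)`. -/
theorem assoc_shift {x y z : L} : Assoc x y z ↔ Assoc (y * inv x) x z := by
  have h := left_moufang (inv x) (x * y) (x * z)
  rw [← flexible, inv_mul_mul, inv_mul_mul] at h
  unfold Assoc
  rw [mul_inv_cancel_right', h]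
  constructor
  · intro k
    rw [k, inv_mul_mul]
  · intro k
    rw [k, mul_inv_mul]

theorem assoc_inv_mid_mul_right {x y z : L} (h : Assoc x y z) : Assoc x (inv y) (z * x) := by
  have h1 := assoc_shift.1 (assoc_reverse (assoc_rotate.1 h))
  have h2 := assoc_rotate.1 (assoc_rotate.1 (assoc_rotate.1 (assoc_rotate.1 h1)))
  simpa only [inv_inv] using h2

theorem assoc_inv_left_mul_inv {x y z : L} (h : Assoc x y z) : Assoc (inv x) y (z * inv x) := by
  refine assoc_rotate.2 ?_
  have h1 : y * z * inv x = y * (z * inv x) := assoc_rotate.1 h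
  change y * (z * inv x) * inv (inv x) = y * (z * inv x * inv (inv x))
  rw [inv_inv, mul_inv_cancel_right', ← h1, mul_inv_cancel_right']

/-- The two preceding lemmas multiply `z` by `x` and then by `x⁻¹`, so together they only invert `x`
and `y`; three rotations turn this into inverting `z` alone. All permutations and inversions of a
triple follow. -/
theorem assoc_inv_right {x y z : L} (h : Assoc x y z) : Assoc x y (inv z) := by
  have h1 := assoc_inv_left_mul_inv (assoc_inv_mid_mul_right h)
  rw [mul_mul_inv] at h1
  simpa only [inv_inv] using assoc_rotate.1 (assoc_rotate.1 (assoc_rotate.1 h1))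

theorem assoc_rotate' {x y z : L} (h : Assoc x y z) : Assoc y z x := by
  simpa only [inv_inv] using assoc_inv_right (assoc_rotate.1 h)

theorem assoc_swap {x y z : L} (h : Assoc x y z) : Assoc y x z :=
  assoc_rotate' (assoc_reverse h)

theorem assoc_inv_left {x y z : L} (h : Assoc x y z) : Assoc (inv x) y z :=
  assoc_rotate' (assoc_rotate' (assoc_inv_right (assoc_rotate' h)))

theorem assoc_inv_mid {x y z : L} (h : Assoc x y z) : Assoc x (inv y) z :=
  assoc_swap (assoc_inv_left (assoc_swap h))

theorem assoc_inv_mul_left {x y z : L} (h : Assoc x y z) : Assoc x y (inv x * z) := by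
  have h1 := assoc_inv_right (assoc_inv_mid (assoc_inv_mid_mul_right (assoc_inv_right h)))
  simpa only [inv_inv, inv_mul_rev] using h1

theorem assoc_mul_left {x y z : L} (h : Assoc x y z) : Assoc x y (x * z) := by
  have h1 := assoc_inv_right (assoc_inv_left (assoc_inv_left_mul_inv (assoc_inv_right h)))
  simpa only [inv_inv, inv_mul_rev] using h1

/-- Left translation, as a permutation. -/
def leftPerm (a : L) : Equiv.Perm L where
  toFun := fun z => a * z
  invFun := fun z => inv a * z
  left_inv := inv_mul_mul a
  right_inv := mul_inv_mul a

/-- The action of the free group through left translations by `x` and `y`. -/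
def leftAction (x y : L) : FreeGroup (Fin 2) →* Equiv.Perm L :=
  FreeGroup.lift ![leftPerm x, leftPerm y]

/-- For `z = 1` this supplies the base case `xy` of diassociativity. -/
theorem assoc_leftAction (x y : L) (w : FreeGroup (Fin 2)) (z : L) (hz : Assoc x y z) :
    Assoc x y (leftAction x y w z) := by
  induction w using FreeGroup.induction_on generalizing z with
  | C1 => simpa using hz
  | of i =>
    fin_cases i
    · exact assoc_mul_left hz
    · exact assoc_swap (assoc_mul_left (assoc_swap hz))
  | inv_of i _ =>
    rw [map_inv]
    fin_cases i
    · exact assoc_inv_mul_left hz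
    · exact assoc_swap (assoc_inv_mul_left (assoc_swap hz))
  | mul a b ha hb =>
    rw [map_mul, Equiv.Perm.mul_apply]
    exact ha _ (hb _ hz)

end MoufangLoop

/-! ### Generating the free group by `a b⁻¹ a`. -/

/-- The smallest subset of a group that contains `1`, `x`, `y`, `x * y` and is closed under
`a * b⁻¹ * a`. -/
inductive TwistedClosure {H : Type*} [Group H] (x y : H) : H → Prop
  | one : TwistedClosure x y 1
  | left : TwistedClosure x y x
  | right : TwistedClosure x y y
  | mul : TwistedClosure x y (x * y)
  | twist {a b : H} : TwistedClosure x y a → TwistedClosure x y b →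
      TwistedClosure x y (a * b⁻¹ * a)

namespace TwistedClosure

variable {H : Type*} [Group H] {x y : H}

theorem inv {a : H} (h : TwistedClosure x y a) : TwistedClosure x y a⁻¹ := by
  simpa using twist (one (x := x) (y := y)) h

theorem twist' {a b : H} (ha : TwistedClosure x y a) (hb : TwistedClosure x y b) :
    TwistedClosure x y (a * b * a) := by
  simpa using twist ha hb.inv

/-- Right multiplication by `c` respects the operation: `(ac)(bc)⁻¹(ac) = a b⁻¹ a c`. Hence only the
four starting elements need checking. -/
theorem mul_of_base {c : H} (h1 : TwistedClosure x y c) (hx : TwistedClosure x y (x * c))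
    (hy : TwistedClosure x y (y * c)) (hxy : TwistedClosure x y (x * y * c)) {a : H}
    (ha : TwistedClosure x y a) : TwistedClosure x y (a * c) := by
  induction ha with
  | one => simpa using h1
  | left => exact hx
  | right => exact hy
  | mul => exact hxy
  | twist _ _ iha ihb =>
    convert twist iha ihb using 1
    group

theorem mul_left_gen {a : H} (ha : TwistedClosure x y a) : TwistedClosure x y (a * x) := by
  have hyx : TwistedClosure x y (y * x) := by
    -- `yx = x (y (xy)⁻¹ y) x`.
    convert twist' left (twist right mul) using 1
    group
  refine mul_of_base left ?_ hyx (twist' left right) ha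
  simpa using twist' (left (x := x) (y := y)) one

theorem mul_right_gen {a : H} (ha : TwistedClosure x y a) : TwistedClosure x y (a * y) := by
  refine mul_of_base right mul ?_ ?_ ha
  · simpa using twist' (right (x := x) (y := y)) one
  · convert twist mul left using 1
    group

theorem gen_mul_inv : TwistedClosure x y (y * x⁻¹) := by
  convert twist' left.inv mul using 1
  group

theorem mul_left_gen_inv {a : H} (ha : TwistedClosure x y a) :
    TwistedClosure x y (a * x⁻¹) := by
  refine mul_of_base left.inv ?_ gen_mul_inv ?_ ha
  · simpa using one
  -- With `c = y x⁻¹`, `x y x⁻¹ = x (c y⁻¹ c) x`.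
  · convert twist' left (twist gen_mul_inv right) using 1
    group

theorem mul_right_gen_inv {a : H} (ha : TwistedClosure x y a) :
    TwistedClosure x y (a * y⁻¹) := by
  refine mul_of_base right.inv ?_ ?_ ?_ ha
  · simpa using (gen_mul_inv (x := x) (y := y)).inv
  · simpa using one
  · simpa using left

/-- In the free group on two generators, the twisted closure is everything. -/
theorem freeGroup (w : FreeGroup (Fin 2)) :
    TwistedClosure (FreeGroup.of 0) (FreeGroup.of 1) w := by
  suffices h : ∀ a, TwistedClosure (FreeGroup.of (0 : Fin 2)) (FreeGroup.of 1) a →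
      TwistedClosure (FreeGroup.of 0) (FreeGroup.of 1) (a * w) by
    simpa using h 1 one
  induction w using FreeGroup.induction_on with
  | C1 => simp
  | of i =>
    fin_cases i
    · exact fun a => mul_left_gen
    · exact fun a => mul_right_gen
  | inv_of i _ =>
    fin_cases i
    · exact fun a => mul_left_gen_inv
    · exact fun a => mul_right_gen_inv
  | mul v w hv hw =>
    intro a ha
    rw [← mul_assoc]
    exact hw _ (hv _ ha)

end TwistedClosure

/-! ### Diassociativity. -/

namespace MoufangLoop

variable {L : Type*} [MoufangLoop L]

/-- The value of an element of the free group at `x`, `y`. -/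
def freeEval (x y : L) (w : FreeGroup (Fin 2)) : L := leftAction x y w 1

/-- Diassociativity: two elements of a Moufang loop generate a group. -/
theorem freeEval_mul (x y : L) (w v : FreeGroup (Fin 2)) :
    freeEval x y (w * v) = freeEval x y w * freeEval x y v := by
  -- The claim says that `w` acts as left translation by its value. The left Moufang identity passes
  -- this from `a, b` to `a b⁻¹ a`.
  induction TwistedClosure.freeGroup w generalizing v with
  | one => simp [freeEval]
  | left => simp [freeEval, leftAction, leftPerm]
  | right => simp [freeEval, leftAction, leftPerm]
  | mul =>
    have h := assoc_leftAction x y v 1 (by simp [Assoc])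
    simpa [freeEval, leftAction, leftPerm, Assoc] using h.symm
  | @twist a b _ _ iha ihb =>
    have hb : ∀ v, freeEval x y (b⁻¹ * v) = inv (freeEval x y b) * freeEval x y v := fun v =>
      eq_inv_mul (by rw [← ihb, mul_inv_cancel_left])
    have key : ∀ v, freeEval x y (a * b⁻¹ * a * v) =
        freeEval x y a * (inv (freeEval x y b) * (freeEval x y a * freeEval x y v)) := by
      intro v
      rw [mul_assoc, mul_assoc, iha, hb, iha]
    -- Taking `v = 1` computes the value of `a b⁻¹ a` itself.
    have h1 := key 1
    rw [_root_.mul_one, show freeEval x y 1 = 1 by simp [freeEval], _root_.mul_one] at h1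
    rw [key v, ← left_moufang, ← h1]

theorem freeEval_one (x y : L) : freeEval x y 1 = 1 := by simp [freeEval]

theorem freeEval_inv (x y : L) (a : FreeGroup (Fin 2)) :
    freeEval x y a⁻¹ = inv (freeEval x y a) :=
  inv_unique (by rw [← freeEval_mul, mul_inv_cancel, freeEval_one])

theorem freeEval_of_zero (x y : L) : freeEval x y (FreeGroup.of 0) = x := by
  simp [freeEval, leftAction, leftPerm]

theorem freeEval_of_one (x y : L) : freeEval x y (FreeGroup.of 1) = y := by
  simp [freeEval, leftAction, leftPerm]

/-! ### Inversion by `u`. -/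

theorem conj_eq_inv {u g : L} (hu : u * u = 1) (h : (g * u) * (g * u) = 1) :
    u * (g * u) = inv g := by
  rw [inv_unique h, inv_mul_rev, ← inv_unique hu, ← left_alternative, hu, one_mul]

/-- Three uses of `conj_mul_inv_mul` peel off `u`, `g`, `u` in turn. With `z = h` and `u(hu) = h⁻¹`
it evaluates `u` on `g h⁻¹ g`. -/
theorem conj_conj_conj (u g z : L) :
    u * ((g * ((u * (z * u)) * g)) * u) = (u * (g * u)) * (z * (u * (g * u))) := by
  have h := conj_mul_inv_mul u (g * ((u * (z * u)) * g)) (inv g * (inv u * (u * (g * u))))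
  rw [conj_mul_inv_mul g, conj_mul_inv_mul u z, inv_mul_mul, inv_mul_mul, inv_mul, mul_one,
    ← left_moufang] at h
  exact h

theorem conj_twist {u g h : L} (hg : u * (g * u) = inv g) (hh : u * (h * u) = inv h) :
    u * ((g * (inv h * g)) * u) = inv (g * (inv h * g)) := by
  rw [← hh, conj_conj_conj, hg, hh, inv_mul_rev, inv_mul_rev, inv_inv, flexible]

theorem conj_freeEval {x y u : L} (hu : u * u = 1) (hx : (x * u) * (x * u) = 1)
    (hy : (y * u) * (y * u) = 1) (hxy : ((x * y) * u) * ((x * y) * u) = 1)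
    (w : FreeGroup (Fin 2)) : u * (freeEval x y w * u) = inv (freeEval x y w) := by
  induction TwistedClosure.freeGroup w with
  | one => rw [freeEval_one, one_mul, hu, inv_one]
  | left => rw [freeEval_of_zero, conj_eq_inv hu hx]
  | right => rw [freeEval_of_one, conj_eq_inv hu hy]
  | mul => rw [freeEval_mul, freeEval_of_zero, freeEval_of_one, conj_eq_inv hu hxy]
  | twist _ _ iha ihb =>
    rw [_root_.mul_assoc, freeEval_mul, freeEval_mul, freeEval_inv]
    exact conj_twist iha ihb

/-! ### Chein's multiplication forced by `u (g u) = g⁻¹`. -/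

section Extend

variable {G : Type*} [Group G] {f : G → L} {u : L}

theorem map_one_of_map_mul (hf : ∀ g h, f (g * h) = f g * f h) : f 1 = 1 :=
  mul_left_cancel' (a := f 1) (by rw [← hf, _root_.mul_one, mul_one])

theorem map_inv_of_map_mul (hf : ∀ g h, f (g * h) = f g * f h) (g : G) :
    f g⁻¹ = inv (f g) :=
  inv_unique (by rw [← hf, mul_inv_cancel, map_one_of_map_mul hf])

theorem mul_gen_eq (hu : u * u = 1) (hc : ∀ g, u * (f g * u) = f g⁻¹) (g : G) :
    f g * u = u * f g⁻¹ := by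
  rw [← hc, ← left_alternative, hu, one_mul]

/-- The three products involving `u` come from the left, right and original Moufang identities
respectively. -/
theorem mul_mul_gen
    (hf : ∀ g h, f (g * h) = f g * f h) (hu : u * u = 1) (hc : ∀ g, u * (f g * u) = f g⁻¹)
    (g h : G) : f g * (f h * u) = f (h * g) * u := by
  have h1 := left_moufang u (f g) (f h⁻¹)
  rw [hc, ← hf] at h1
  rw [mul_gen_eq hu hc h, mul_gen_eq hu hc (h * g), mul_inv_rev, h1, ← left_alternative,
    hu, one_mul]

theorem mul_gen_mul
    (hf : ∀ g h, f (g * h) = f g * f h) (hu : u * u = 1) (hc : ∀ g, u * (f g * u) = f g⁻¹)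
    (g h : G) : (f g * u) * f h = f (g * h⁻¹) * u := by
  have h1 := right_moufang u (f h) (f g)
  rw [hc, ← hf] at h1
  rw [h1]
  have h2 := mul_mul_inv (f g * u * f h) u
  rwa [← inv_unique hu, eq_comm] at h2

theorem mul_gen_mul_mul_gen
    (hf : ∀ g h, f (g * h) = f g * f h) (hu : u * u = 1) (hc : ∀ g, u * (f g * u) = f g⁻¹)
    (g h : G) : (f g * u) * (f h * u) = f (h⁻¹ * g) := by
  rw [mul_gen_eq hu hc g, moufang, ← hf, hc, mul_inv_rev, _root_.inv_inv]

end Extend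

/-- The extension to Chein's loop of a map from `G` and an element `u`. -/
def cheinMap {G : Type*} (f : G → L) (u : L) (a : CheinLoop G) : L :=
  if a.exp = 0 then f a.elt else f a.elt * u

theorem cheinMap_mul {G : Type*} [Group G] {f : G → L} {u : L}
    (hf : ∀ g h, f (g * h) = f g * f h) (hu : u * u = 1) (hc : ∀ g, u * (f g * u) = f g⁻¹)
    (a b : CheinLoop G) : cheinMap f u (a * b) = cheinMap f u a * cheinMap f u b := by
  revert b
  revert a
  refine CheinLoop.cases_exp ?_ ?_ <;> intro g <;> refine CheinLoop.cases_exp ?_ ?_ <;> intro h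
  · rw [CheinLoop.mk_zero_mul_mk_zero]
    simp [cheinMap, hf]
  · rw [CheinLoop.mk_zero_mul_mk_one]
    simp [cheinMap, mul_mul_gen hf hu hc]
  · rw [CheinLoop.mk_one_mul_mk_zero]
    simp [cheinMap, mul_gen_mul hf hu hc]
  · rw [CheinLoop.mk_one_mul_mk_one]
    simp [cheinMap, mul_gen_mul_mul_gen hf hu hc]

theorem map_ldiv_of_map_mul {M : Type*} [MoufangLoop M] {f : L → M}
    (hf : ∀ a b, f (a * b) = f a * f b) (a b : L) : f (ldiv a b) = ldiv (f a) (f b) :=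
  mul_left_cancel' (a := f a) (by rw [← hf, mul_ldiv, mul_ldiv])

theorem map_rdiv_of_map_mul {M : Type*} [MoufangLoop M] {f : L → M}
    (hf : ∀ a b, f (a * b) = f a * f b) (a b : L) : f (rdiv b a) = rdiv (f b) (f a) :=
  mul_right_cancel' (a := f a) (by rw [← hf, rdiv_mul, rdiv_mul])

theorem map_one_of_map_mul' {M : Type*} [MoufangLoop M] {f : L → M}
    (hf : ∀ a b, f (a * b) = f a * f b) : f 1 = 1 :=
  mul_left_cancel' (a := f 1) (by rw [← hf, mul_one, mul_one])

end MoufangLoop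

/-! ### Evaluating words; maps out of presented loops and groups. -/

namespace LoopWord

open MoufangLoop

variable {α : Type} {L : Type*} [MoufangLoop L]

/-- The value of a word in a Moufang loop. -/
def eval (v : α → L) : LoopWord α → L
  | var a => v a
  | one => 1
  | mul p q => eval v p * eval v q
  | ldiv p q => MoufangLoop.ldiv (eval v p) (eval v q)
  | rdiv p q => MoufangLoop.rdiv (eval v p) (eval v q)

theorem eval_map {β : Type} (f : α → β) (v : β → L) (w : LoopWord α) :
    eval v (w.map f) = eval (v ∘ f) w := by
  induction w with
  | var a => rfl
  | one => rfl
  | mul p q hp hq => simp [LoopWord.map, eval, hp, hq]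
  | ldiv p q hp hq => simp [LoopWord.map, eval, hp, hq]
  | rdiv p q hp hq => simp [LoopWord.map, eval, hp, hq]

/-- A multiplicative map from a free group evaluates words as they are read in groups. -/
theorem eval_eq_of_map_mul {F : FreeGroup α → L} (hF : ∀ a b, F (a * b) = F a * F b)
    (w : LoopWord α) : eval (fun a => F (FreeGroup.of a)) w = F w.toFreeGroup := by
  induction w with
  | var a => rfl
  | one => exact (map_one_of_map_mul hF).symm
  | mul p q hp hq => simp [toFreeGroup, eval, hp, hq, hF]
  | ldiv p q hp hq => simp [toFreeGroup, eval, hp, hq, hF, ldiv_eq, map_inv_of_map_mul hF]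
  | rdiv p q hp hq => simp [toFreeGroup, eval, hp, hq, hF, rdiv_eq, map_inv_of_map_mul hF]

theorem eval_mk (R : Set (LoopWord α × LoopWord α)) (w : LoopWord α) :
    eval (MoufangPresentedBy.of R) w = MoufangPresentedBy.mk R w := by
  induction w with
  | var a => rfl
  | one => rfl
  | mul p q hp hq => rw [eval, hp, hq]; rfl
  | ldiv p q hp hq => rw [eval, hp, hq]; rfl
  | rdiv p q hp hq => rw [eval, hp, hq]; rfl

theorem eval_eq_of_derivable {R : Set (LoopWord α × LoopWord α)} {v : α → L}
    (hR : ∀ p ∈ R, eval v p.1 = eval v p.2) {p q : LoopWord α} (h : MoufangDerivable R p q) :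
    eval v p = eval v q := by
  induction h with
  | rel h => exact hR _ h
  | refl => rfl
  | symm _ ih => exact ih.symm
  | trans _ _ ih1 ih2 => exact ih1.trans ih2
  | mul_congr _ _ ih1 ih2 => rw [eval, eval, ih1, ih2]
  | ldiv_congr _ _ ih1 ih2 => rw [eval, eval, ih1, ih2]
  | rdiv_congr _ _ ih1 ih2 => rw [eval, eval, ih1, ih2]
  | one_mul => exact MoufangLoop.toMulOneClass.one_mul _
  | mul_one => exact MoufangLoop.toMulOneClass.mul_one _
  | mul_ldiv => exact MoufangLoop.mul_ldiv _ _
  | ldiv_mul => exact MoufangLoop.ldiv_mul _ _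
  | rdiv_mul => exact MoufangLoop.rdiv_mul _ _
  | mul_rdiv => exact MoufangLoop.mul_rdiv _ _
  | moufang => exact MoufangLoop.moufang _ _ _

end LoopWord

namespace MoufangPresentedBy

variable {α : Type} {R : Set (LoopWord α × LoopWord α)} {L : Type*} [MoufangLoop L]

/-- The homomorphism from a presented Moufang loop given by elements that satisfy the relations. -/
def lift (v : α → L) (hR : ∀ p ∈ R, p.1.eval v = p.2.eval v) : MoufangPresentedBy R → L :=
  Quotient.lift (LoopWord.eval v) fun _ _ h => LoopWord.eval_eq_of_derivable hR h

theorem lift_mul (v : α → L) (hR : ∀ p ∈ R, p.1.eval v = p.2.eval v)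
    (a b : MoufangPresentedBy R) : lift v hR (a * b) = lift v hR a * lift v hR b := by
  obtain ⟨a⟩ := a
  obtain ⟨b⟩ := b
  rfl

theorem eval_eq {p : LoopWord α × LoopWord α} (hp : p ∈ R) :
    p.1.eval (of R) = p.2.eval (of R) := by
  rw [LoopWord.eval_mk, LoopWord.eval_mk]
  exact Quotient.sound (.rel hp)

/-- A multiplicative map is determined by the images of the generators. -/
theorem eq_lift_of_map_mul {v : α → L} (hR : ∀ p ∈ R, p.1.eval v = p.2.eval v)
    {f : MoufangPresentedBy R → L} (hf : ∀ a b, f (a * b) = f a * f b)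
    (hv : ∀ a, f (of R a) = v a) (a : MoufangPresentedBy R) : f a = lift v hR a := by
  obtain ⟨w⟩ := a
  change f (mk R w) = w.eval v
  induction w with
  | var a => exact hv a
  | one => exact MoufangLoop.map_one_of_map_mul' hf
  | mul p q hp hq => rw [LoopWord.eval, ← hp, ← hq, ← hf]; rfl
  | ldiv p q hp hq => rw [LoopWord.eval, ← hp, ← hq, ← MoufangLoop.map_ldiv_of_map_mul hf]; rfl
  | rdiv p q hp hq => rw [LoopWord.eval, ← hp, ← hq, ← MoufangLoop.map_rdiv_of_map_mul hf]; rfl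

end MoufangPresentedBy

namespace CheinLoop

variable {G : Type*} [Group G]

theorem ofGroup_mul (g h : G) : ofGroup (g * h) = ofGroup g * ofGroup h :=
  (mk_zero_mul_mk_zero g h).symm

theorem mk_one_mul_self (g : G) : (⟨g, 1⟩ : CheinLoop G) * ⟨g, 1⟩ = 1 := by
  rw [mk_one_mul_mk_one, inv_mul_cancel, one_def]

theorem ofGroup_mul_u (g : G) : ofGroup g * u = ⟨g, 1⟩ := by
  rw [ofGroup, u, mk_zero_mul_mk_one, one_mul]

end CheinLoop

theorem IsGroupPresentation.exists_lift_eq {α : Type} {R : Set (LoopWord α × LoopWord α)}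
    {G : Type*} [Group G] {v : α → G} (hG : IsGroupPresentation R v) :
    ∃ φ : GroupPresentedBy R ≃* G, ∀ w, FreeGroup.lift v w = φ (PresentedGroup.mk _ w) := by
  obtain ⟨φ, hφ⟩ := hG
  have h : FreeGroup.lift v = φ.toMonoidHom.comp (PresentedGroup.mk _) := by
    ext a
    rw [FreeGroup.lift_apply_of]
    exact (hφ a).symm
  exact ⟨φ, fun w => DFunLike.congr_fun h w⟩

theorem IsGroupPresentation.toFreeGroup_eq {α : Type} {R : Set (LoopWord α × LoopWord α)}
    {G : Type*} [Group G] {v : α → G} (hG : IsGroupPresentation R v)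
    {p : LoopWord α × LoopWord α} (hp : p ∈ R) :
    FreeGroup.lift v p.1.toFreeGroup = FreeGroup.lift v p.2.toFreeGroup := by
  obtain ⟨φ, h⟩ := hG.exists_lift_eq
  rw [← div_eq_one, ← map_div, div_eq_mul_inv, h,
    PresentedGroup.one_of_mem (Set.mem_image_of_mem _ hp), map_one]

theorem IsGroupPresentation.lift_surjective {α : Type} {R : Set (LoopWord α × LoopWord α)}
    {G : Type*} [Group G] {v : α → G} (hG : IsGroupPresentation R v) :
    Function.Surjective (FreeGroup.lift v) := by
  obtain ⟨φ, h⟩ := hG.exists_lift_eq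
  rw [funext h]
  exact φ.surjective.comp (QuotientGroup.mk'_surjective _)

/-- A multiplicative map from the free group to a Moufang loop that satisfies the relations
of a presentation factors through the presented group. -/
theorem IsGroupPresentation.map_eq_of_lift_eq {α : Type} {R : Set (LoopWord α × LoopWord α)}
    {G : Type*} [Group G] {v : α → G} (hG : IsGroupPresentation R v)
    {L : Type*} [MoufangLoop L] {F : FreeGroup α → L} (hF : ∀ a b, F (a * b) = F a * F b)
    (hR : ∀ p ∈ R, F p.1.toFreeGroup = F p.2.toFreeGroup) {a b : FreeGroup α}
    (h : FreeGroup.lift v a = FreeGroup.lift v b) : F a = F b := by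
  have hF1 := MoufangLoop.map_one_of_map_mul hF
  have hFi := MoufangLoop.map_inv_of_map_mul hF
  -- The kernel of `F` is a normal subgroup although `L` need not be associative: the checks only
  -- drop factors equal to `1`.
  let N : Subgroup (FreeGroup α) :=
    { carrier := {a | F a = 1}
      mul_mem' := fun {a b} ha hb => by
        change F (a * b) = 1
        rw [hF, ha, hb, mul_one]
      one_mem' := hF1
      inv_mem' := fun {a} ha => by
        change F a⁻¹ = 1
        rw [hFi, ha, MoufangLoop.inv_one] }
  have hN : N.Normal := ⟨fun n hn g => by
    change F (g * n * g⁻¹) = 1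
    rw [hF, hF, show F n = 1 from hn, mul_one, ← hF, mul_inv_cancel, hF1]⟩
  obtain ⟨φ, hφ⟩ := hG.exists_lift_eq
  rw [hφ, hφ] at h
  have h1 : b⁻¹ * a ∈ N := by
    refine Subgroup.normalClosure_le_normal ?_ (QuotientGroup.eq.1 (φ.injective h).symm)
    rintro _ ⟨p, hp, rfl⟩
    change F _ = 1
    rw [hF, hFi, hR p hp, MoufangLoop.mul_inv]
  rw [← mul_inv_cancel_left b a, hF, show F (b⁻¹ * a) = 1 from h1, mul_one]

/-! ### The two mutually inverse homomorphisms. -/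

open MoufangLoop in
theorem eval_cheinRelations {G : Type*} [Group G] {x y : G}
    {R : Set (LoopWord (Fin 2) × LoopWord (Fin 2))} (hG : IsGroupPresentation R ![x, y]) :
    ∀ p ∈ cheinRelations R,
      p.1.eval ![CheinLoop.ofGroup x, CheinLoop.ofGroup y, (CheinLoop.u : CheinLoop G)] =
        p.2.eval ![CheinLoop.ofGroup x, CheinLoop.ofGroup y, (CheinLoop.u : CheinLoop G)] := by
  rintro p (⟨q, hq, rfl⟩ | hp)
  · have hv : (![CheinLoop.ofGroup x, CheinLoop.ofGroup y, (CheinLoop.u : CheinLoop G)] ∘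
        Fin.castSucc) =
          fun i => CheinLoop.ofGroup (FreeGroup.lift ![x, y] (FreeGroup.of i)) := by
      funext i
      fin_cases i <;> simp
    rw [Prod.map_fst, Prod.map_snd, LoopWord.eval_map, LoopWord.eval_map, hv]
    have hm : ∀ a b : FreeGroup (Fin 2), CheinLoop.ofGroup (FreeGroup.lift ![x, y] (a * b)) =
        CheinLoop.ofGroup (FreeGroup.lift ![x, y] a) *
          CheinLoop.ofGroup (FreeGroup.lift ![x, y] b) := fun a b => by
      rw [map_mul, CheinLoop.ofGroup_mul]
    have he := LoopWord.eval_eq_of_map_mul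
      (F := fun a => CheinLoop.ofGroup (FreeGroup.lift ![x, y] a)) hm
    rw [he, he, hG.toFreeGroup_eq hq]
  · rcases hp with rfl | rfl | rfl | rfl
    · exact CheinLoop.mk_one_mul_self (1 : G)
    all_goals
      simp [LoopWord.sq, LoopWord.eval, ← CheinLoop.ofGroup_mul, CheinLoop.ofGroup_mul_u,
        CheinLoop.mk_one_mul_self]

theorem theorem3p1 {G : Type*} [Group G] [Finite G] (x y : G)
    (R : Set (LoopWord (Fin 2) × LoopWord (Fin 2)))
    (hG : IsGroupPresentation R ![x, y]) :
    IsMoufangPresentation (cheinRelations R)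
      ![CheinLoop.ofGroup x, CheinLoop.ofGroup y, (CheinLoop.u : CheinLoop G)] := by
  set π := FreeGroup.lift ![x, y] with hπ
  set X := MoufangPresentedBy.of (cheinRelations R) 0 with hX
  set Y := MoufangPresentedBy.of (cheinRelations R) 1 with hY
  set U := MoufangPresentedBy.of (cheinRelations R) 2 with hU
  have hrel {p} (hp : p ∈ cheinRelations R) := MoufangPresentedBy.eval_eq hp
  have hUU : U * U = 1 := hrel (p := (_, _)) (.inr (.inl rfl))
  have hXU : (X * U) * (X * U) = 1 := hrel (p := (_, _)) (.inr (.inr (.inl rfl)))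
  have hYU : (Y * U) * (Y * U) = 1 := hrel (p := (_, _)) (.inr (.inr (.inr (.inl rfl))))
  have hXYU : ((X * Y) * U) * ((X * Y) * U) = 1 :=
    hrel (p := (_, _)) (.inr (.inr (.inr (.inr rfl))))
  have hF := MoufangLoop.freeEval_mul X Y
  have hFR : ∀ p ∈ R, MoufangLoop.freeEval X Y p.1.toFreeGroup =
      MoufangLoop.freeEval X Y p.2.toFreeGroup := by
    intro p hp
    have hv : (fun i => MoufangLoop.freeEval X Y (FreeGroup.of i)) =
        MoufangPresentedBy.of (cheinRelations R) ∘ Fin.castSucc := by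
      funext i
      fin_cases i
      · exact MoufangLoop.freeEval_of_zero X Y
      · exact MoufangLoop.freeEval_of_one X Y
    rw [← LoopWord.eval_eq_of_map_mul hF, ← LoopWord.eval_eq_of_map_mul hF, hv,
      ← LoopWord.eval_map, ← LoopWord.eval_map]
    exact hrel (.inl ⟨p, hp, rfl⟩)
  have hs : Function.Surjective π := hG.lift_surjective
  -- An arbitrary section of `π` is used; `hfπ` shows that the choice does not matter.
  set f : G → MoufangPresentedBy (cheinRelations R) :=
    fun g => MoufangLoop.freeEval X Y (Function.surjInv hs g) with hfdef
  have hfπ (w) : f (π w) = MoufangLoop.freeEval X Y w :=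
    hG.map_eq_of_lift_eq hF hFR (Function.surjInv_eq hs (π w))
  have hf : ∀ g h, f (g * h) = f g * f h := by
    intro g h
    obtain ⟨a, rfl⟩ := hs g
    obtain ⟨b, rfl⟩ := hs h
    rw [← map_mul, hfπ, hfπ, hfπ, hF]
  have hc : ∀ g, U * (f g * U) = f g⁻¹ := by
    intro g
    obtain ⟨a, rfl⟩ := hs g
    rw [← map_inv, hfπ, hfπ, MoufangLoop.conj_freeEval hUU hXU hYU hXYU, MoufangLoop.freeEval_inv]
  have hfx : f x = X := by
    rw [← MoufangLoop.freeEval_of_zero X Y, ← hfπ, hπ, FreeGroup.lift_apply_of]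
    rfl
  have hfy : f y = Y := by
    rw [← MoufangLoop.freeEval_of_one X Y, ← hfπ, hπ, FreeGroup.lift_apply_of]
    rfl
  have hf1 : f 1 = 1 := MoufangLoop.map_one_of_map_mul hf
  have hψ := MoufangLoop.cheinMap_mul hf hUU hc
  set ψ := MoufangLoop.cheinMap f U with hψdef
  have hE := eval_cheinRelations hG
  set φ := MoufangPresentedBy.lift _ hE with hφdef
  have hφ : ∀ a b, φ (a * b) = φ a * φ b := MoufangPresentedBy.lift_mul _ hE
  -- Both `ψ ∘ φ` and `id` are multiplicative and fix the generators, so both equal the same lift.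
  have hψφ (a) : ψ (φ a) = a := by
    have hR := fun p => MoufangPresentedBy.eval_eq (R := cheinRelations R) (p := p)
    rw [MoufangPresentedBy.eq_lift_of_map_mul (f := fun a => ψ (φ a)) hR
      (fun a b => by rw [hφ, hψ]),
      ← MoufangPresentedBy.eq_lift_of_map_mul (f := id) hR (fun a b => rfl) (fun a => rfl), id]
    intro i
    fin_cases i
    · exact hfx
    · exact hfy
    · change (if (1 : ZMod 2) = 0 then f 1 else f 1 * U) = U
      rw [if_neg one_ne_zero, hf1, one_mul]
  have hφf (g) : φ (f g) = CheinLoop.ofGroup g := by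
    obtain ⟨w, rfl⟩ := hs g
    induction w using FreeGroup.induction_on with
    | C1 => rw [map_one, hf1]; rfl
    | of i =>
      rw [hπ, FreeGroup.lift_apply_of]
      fin_cases i
      · exact congrArg φ hfx
      · exact congrArg φ hfy
    | inv_of i ih =>
      rw [map_inv, MoufangLoop.map_inv_of_map_mul (f := fun g => φ (f g))
        (fun g h => by rw [hf, hφ]), ih,
        ← MoufangLoop.map_inv_of_map_mul CheinLoop.ofGroup_mul]
    | mul a b ha hb => rw [map_mul, hf, hφ, ha, hb, CheinLoop.ofGroup_mul]
  have hφψ : ∀ a, φ (ψ a) = a := by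
    refine CheinLoop.cases_exp ?_ ?_ <;> intro g
    · exact hφf g
    · change φ (if (1 : ZMod 2) = 0 then f g else f g * U) = _
      rw [if_neg one_ne_zero, hφ, hφf]
      exact CheinLoop.ofGroup_mul_u g
  exact ⟨{ toFun := φ, invFun := ψ, left_inv := hψφ, right_inv := hφψ, map_mul' := hφ },
    fun _ => rfl⟩
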